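/- Fix integers $d,n\ge 0$. Let $CS^d_n$ be the set of $d$-tuples $S=(S^1,\dots,S^d)$ of pairwise commuting self-adjoint complex $n\times n$ matrices. Every $S\in CS^d_n$ is diagonalized by some unitary matrix $U$: $S^r=U\,\mathrm{diag}(x^r_1,\dots,x^r_n)\,U^*$ for $1\le r\le d$; put $x_i=(x_i^1,\dots,x_i^d)\in\mathbb R^d$ and let $\sigma(S)=\{x_1,\dots,x_n\}$ be the joint spectrum of $S$. A real-valued function $f$ defined on a set containing $\sigma(S)$ induces the matrix $F(S)=U\,\mathrm{diag}(f(x_1),\dots,f(x_n))\,U^*$, which does not depend on the choice of the diagonalization. **Theorem.** Let $I\subseteq\mathbb R$ be an interval, let $S(t)$, $t\in I$, be a $C^1$ curve with values in $CS^d_n$, let $\Omega\subseteq\mathbb R^d$ be an open set with $\sigma(S(t))\subseteq\Omega$ for all $t\in I$, and let $f\in C^1(\Omega,\mathbb R)$. Then the derivative $\frac{d}{dt}F(S(t))\big|_{t=t^*}$ exists for every $t^*\in I$ and is continuous as a function of $t^*$ on $I$. (At an endpoint of $I$ that belongs to $I$, derivatives are one-sided.) -/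

import Mathlib

open scoped Matrix Matrix.Norms.L2Operator

noncomputable section

namespace MatrixFunction

/-- `CS d n`: the `d`-tuples of pairwise-commuting self-adjoint complex `n × n` matrices. -/
def CS (d n : ℕ) : Set (Fin d → Matrix (Fin n) (Fin n) ℂ) :=
  {S | (∀ r, (S r).IsHermitian) ∧ ∀ r s, Commute (S r) (S s)}

/-- The unitary matrix `U` diagonalizes every `S r`, and the diagonal of `U* (S r) U` is
`(x 1 r, …, x n r)`: the points `x i` of `ℝ^d` are the joint eigenvalues of `S`, listed with
multiplicity. -/
def Diagonalizes {d n : ℕ} (U : Matrix.unitaryGroup (Fin n) ℂ) (x : Fin n → Fin d → ℝ)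
    (S : Fin d → Matrix (Fin n) (Fin n) ℂ) : Prop :=
  ∀ r, S r = (U : Matrix (Fin n) (Fin n) ℂ) * Matrix.diagonal (fun i => (x i r : ℂ)) *
    (U : Matrix (Fin n) (Fin n) ℂ)ᴴ

/-- The joint spectrum `{x 1, …, x n}` of a tuple of matrices. -/
def jointSpectrum {d n : ℕ} (S : Fin d → Matrix (Fin n) (Fin n) ℂ) : Set (Fin d → ℝ) :=
  {p | ∃ U x, Diagonalizes U x S ∧ p ∈ Set.range x}

open Classical in
/-- The matrix function induced by `f : ℝ^d → ℝ`:
`F(S) = U diag(f (x 1), …, f (x n)) U*` for a unitary `U` that diagonalizes `S`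
(and `0` when `S` is not jointly diagonalizable, which does not happen on `CS d n`).
The value does not depend on the diagonalization, see `induced_eq`. -/
def induced {d n : ℕ} (f : (Fin d → ℝ) → ℝ) (S : Fin d → Matrix (Fin n) (Fin n) ℂ) :
    Matrix (Fin n) (Fin n) ℂ :=
  if h : ∃ p : Matrix.unitaryGroup (Fin n) ℂ × (Fin n → Fin d → ℝ), Diagonalizes p.1 p.2 S then
    (h.choose.1 : Matrix (Fin n) (Fin n) ℂ) *
      Matrix.diagonal (fun i => (f (h.choose.2 i) : ℂ)) *
      (h.choose.1 : Matrix (Fin n) (Fin n) ℂ)ᴴ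
  else 0

/-- Two diagonalizations are intertwined by a matrix that only links equal joint eigenvalues. -/
theorem Diagonalizes.link {d n : ℕ} {S : Fin d → Matrix (Fin n) (Fin n) ℂ}
    {U V : Matrix.unitaryGroup (Fin n) ℂ} {x y : Fin n → Fin d → ℝ}
    (hU : Diagonalizes U x S) (hV : Diagonalizes V y S) (i j : Fin n) :
    x i = y j ∨ ((U : Matrix (Fin n) (Fin n) ℂ)ᴴ * (V : Matrix (Fin n) (Fin n) ℂ)) i j = 0 := by
  have hUU : (U : Matrix (Fin n) (Fin n) ℂ)ᴴ * (U : Matrix (Fin n) (Fin n) ℂ) = 1 :=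
    Matrix.UnitaryGroup.star_mul_self U
  have hVV : (V : Matrix (Fin n) (Fin n) ℂ)ᴴ * (V : Matrix (Fin n) (Fin n) ℂ) = 1 :=
    Matrix.UnitaryGroup.star_mul_self V
  by_cases h : x i = y j
  · exact Or.inl h
  right
  obtain ⟨r, hr⟩ := Function.ne_iff.mp h
  have e1 := hU r
  rw [hV r] at e1
  have e2 := congrArg (fun M => (U : Matrix (Fin n) (Fin n) ℂ)ᴴ * M *
    (V : Matrix (Fin n) (Fin n) ℂ)) e1
  simp only [Matrix.mul_assoc, hVV, Matrix.mul_one] at e2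
  rw [← Matrix.mul_assoc, ← Matrix.mul_assoc (U : Matrix (Fin n) (Fin n) ℂ)ᴴ
    (U : Matrix (Fin n) (Fin n) ℂ), hUU, Matrix.one_mul] at e2
  have e3 := congrFun (congrFun e2 i) j
  rw [Matrix.mul_diagonal, Matrix.diagonal_mul, mul_comm] at e3
  have e4 : ((y j r : ℂ) - x i r) *
      ((U : Matrix (Fin n) (Fin n) ℂ)ᴴ * (V : Matrix (Fin n) (Fin n) ℂ)) i j = 0 := by
    rw [sub_mul, e3, sub_self]
  rcases mul_eq_zero.mp e4 with h0 | h0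
  · exact absurd (by exact_mod_cast (sub_eq_zero.mp h0).symm) hr
  · exact h0

/-- `F(S)` can be computed from any diagonalization of `S`. -/
theorem induced_eq {d n : ℕ} (f : (Fin d → ℝ) → ℝ) {S : Fin d → Matrix (Fin n) (Fin n) ℂ}
    {U : Matrix.unitaryGroup (Fin n) ℂ} {x : Fin n → Fin d → ℝ} (hU : Diagonalizes U x S) :
    induced f S = (U : Matrix (Fin n) (Fin n) ℂ) * Matrix.diagonal (fun i => (f (x i) : ℂ)) *
      (U : Matrix (Fin n) (Fin n) ℂ)ᴴ := by
  have h : ∃ p : Matrix.unitaryGroup (Fin n) ℂ × (Fin n → Fin d → ℝ), Diagonalizes p.1 p.2 S :=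
    ⟨(U, x), hU⟩
  rw [induced, dif_pos h]
  have hV := h.choose_spec
  generalize h.choose.1 = V at hV ⊢
  generalize h.choose.2 = y at hV ⊢
  have key : Matrix.diagonal (fun i => (f (x i) : ℂ)) *
      ((U : Matrix (Fin n) (Fin n) ℂ)ᴴ * (V : Matrix (Fin n) (Fin n) ℂ)) =
      ((U : Matrix (Fin n) (Fin n) ℂ)ᴴ * (V : Matrix (Fin n) (Fin n) ℂ)) *
        Matrix.diagonal (fun i => (f (y i) : ℂ)) := by
    ext i j
    rw [Matrix.mul_diagonal, Matrix.diagonal_mul]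
    rcases hU.link hV i j with h | h
    · rw [h, mul_comm]
    · rw [h, mul_zero, zero_mul]
  have hUU : (U : Matrix (Fin n) (Fin n) ℂ) * (U : Matrix (Fin n) (Fin n) ℂ)ᴴ = 1 :=
    Matrix.mem_unitaryGroup_iff.mp U.2
  have hVV : (V : Matrix (Fin n) (Fin n) ℂ) * (V : Matrix (Fin n) (Fin n) ℂ)ᴴ = 1 :=
    Matrix.mem_unitaryGroup_iff.mp V.2
  have k2 := congrArg (fun M => (U : Matrix (Fin n) (Fin n) ℂ) * M *
    (V : Matrix (Fin n) (Fin n) ℂ)ᴴ) key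
  simp only [Matrix.mul_assoc, hVV, Matrix.mul_one] at k2
  rw [← Matrix.mul_assoc (U : Matrix (Fin n) (Fin n) ℂ) (U : Matrix (Fin n) (Fin n) ℂ)ᴴ, hUU,
    Matrix.one_mul] at k2
  rw [Matrix.mul_assoc, Matrix.mul_assoc, k2]

/-- The joint spectrum can be read off any diagonalization of `S`. -/
theorem jointSpectrum_eq {d n : ℕ} {S : Fin d → Matrix (Fin n) (Fin n) ℂ}
    {U : Matrix.unitaryGroup (Fin n) ℂ} {x : Fin n → Fin d → ℝ} (hU : Diagonalizes U x S) :
    jointSpectrum S = Set.range x := by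
  refine Set.Subset.antisymm ?_ (fun p hp => ⟨U, x, hU, hp⟩)
  rintro _ ⟨V, y, hV, j, rfl⟩
  by_contra hj
  have hz : ∀ i, ((U : Matrix (Fin n) (Fin n) ℂ)ᴴ * (V : Matrix (Fin n) (Fin n) ℂ)) i j = 0 :=
    fun i => (hU.link hV i j).resolve_left (fun h => hj ⟨i, h⟩)
  have hW : ((U : Matrix (Fin n) (Fin n) ℂ)ᴴ * (V : Matrix (Fin n) (Fin n) ℂ))ᴴ *
      ((U : Matrix (Fin n) (Fin n) ℂ)ᴴ * (V : Matrix (Fin n) (Fin n) ℂ)) = 1 :=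
    Matrix.UnitaryGroup.star_mul_self (U⁻¹ * V)
  have h1 := congrFun (congrFun hW j) j
  rw [Matrix.mul_apply, Matrix.one_apply_eq] at h1
  simp [hz] at h1

/-- Every tuple in `CS d n` has an orthonormal basis of joint eigenvectors. -/
theorem exists_basis {d n : ℕ} {S : Fin d → Matrix (Fin n) (Fin n) ℂ} (hS : S ∈ CS d n) :
    ∃ (B : OrthonormalBasis (Fin n) ℂ (EuclideanSpace ℂ (Fin n))) (x : Fin n → Fin d → ℝ),
      ∀ i r, Matrix.toEuclideanLin (S r) (B i) = (x i r : ℂ) • B i := by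
  classical
  obtain ⟨hH, hC⟩ := hS
  let T : Fin d → Module.End ℂ (EuclideanSpace ℂ (Fin n)) := fun r => Matrix.toEuclideanLin (S r)
  have hT : ∀ r, (T r).IsSymmetric := fun r => Matrix.isSymmetric_toEuclideanLin_iff.mpr (hH r)
  have hTC : Pairwise (Function.onFun Commute T) := by
    intro r s _
    ext1 v
    have := congrArg (fun M => M *ᵥ v.ofLp) (hC r s).eq
    simpa [T, Matrix.toLpLin_apply, Matrix.mulVec_mulVec] using this
  have hint := LinearMap.IsSymmetric.directSum_isInternal_of_pairwise_commute hT hTC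
  have horth := LinearMap.IsSymmetric.orthogonalFamily_iInf_eigenspaces hT
  let b0 := fun χ : Fin d → ℂ => stdOrthonormalBasis ℂ
    (⨅ j, Module.End.eigenspace (T j) (χ j) : Submodule ℂ (EuclideanSpace ℂ (Fin n)))
  let b := hint.collectedBasis (fun χ => (b0 χ).toBasis)
  have hb : Orthonormal ℂ b := by
    have := horth.orthonormal_sigma_orthonormal (v_family := fun χ => b0 χ)
      (fun χ => (b0 χ).orthonormal)
    simpa [b, hint.collectedBasis_coe] using this
  have : Fintype (Σ χ : Fin d → ℂ, Fin (Module.finrank ℂ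
      (⨅ j, Module.End.eigenspace (T j) (χ j) : Submodule ℂ (EuclideanSpace ℂ (Fin n))))) :=
    FiniteDimensional.fintypeBasisIndex b
  have hcard := Module.finrank_eq_card_basis b
  rw [finrank_euclideanSpace_fin] at hcard
  let e := (Fintype.equivFinOfCardEq hcard.symm)
  let B := (b.toOrthonormalBasis hb).reindex e
  have hB : ∀ i r, T r (B i) = ((e.symm i).1 r) • B i := by
    intro i r
    have hm : B i ∈ (⨅ j, Module.End.eigenspace (T j) ((e.symm i).1 j) :
        Submodule ℂ (EuclideanSpace ℂ (Fin n))) := by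
      simp [B, b, hint.collectedBasis_coe, -Submodule.mem_iInf]
    exact Module.End.mem_eigenspace_iff.mp ((Submodule.mem_iInf _).mp hm r)
  have hreal : ∀ i r, (((e.symm i).1 r).re : ℂ) = (e.symm i).1 r := by
    intro i r
    have hne : B i ≠ 0 := B.orthonormal.ne_zero i
    exact Complex.conj_eq_iff_re.mp ((hT r).conj_eigenvalue_eq_self
      (Module.End.hasEigenvalue_of_hasEigenvector
        ⟨Module.End.mem_eigenspace_iff.mpr (hB i r), hne⟩))
  exact ⟨B, fun i r => ((e.symm i).1 r).re, fun i r => by rw [hreal]; exact hB i r⟩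

/-- Every tuple in `CS d n` is jointly diagonalizable by a unitary matrix. -/
theorem exists_diagonalizes {d n : ℕ} {S : Fin d → Matrix (Fin n) (Fin n) ℂ} (hS : S ∈ CS d n) :
    ∃ U x, Diagonalizes U x S := by
  obtain ⟨B, x, hB⟩ := exists_basis hS
  let U : Matrix (Fin n) (Fin n) ℂ := Matrix.of fun i j => B j i
  have hU : Uᴴ * U = 1 := by
    ext i j
    rw [Matrix.one_apply, ← orthonormal_iff_ite.mp B.orthonormal i j, Matrix.mul_apply,
      PiLp.inner_apply]
    exact Finset.sum_congr rfl fun k _ => mul_comm _ _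
  refine ⟨⟨U, Matrix.mem_unitaryGroup_iff'.mpr hU⟩, x, fun r => ?_⟩
  have hSU : S r * U = U * Matrix.diagonal (fun i => (x i r : ℂ)) := by
    ext i j
    have := congrArg (fun v : EuclideanSpace ℂ (Fin n) => v i) (hB j r)
    rw [Matrix.mul_diagonal, mul_comm]
    exact this
  have hU' : U * Uᴴ = 1 := mul_eq_one_comm.mp hU
  change S r = U * Matrix.diagonal (fun i => (x i r : ℂ)) * Uᴴ
  rw [← hSU, Matrix.mul_assoc, hU', Matrix.mul_one]

end MatrixFunction

end

/-!
Fix `t` in the interval. A polynomial `p` on `ℝ^d` is chosen that agrees with `f` to first order at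
the finitely many points of the joint spectrum of `S t` (`exists_polyFun_hermite`), and `F` is split
as `F = P + R` with `P` and `R` induced by `p` and `f - p`.

The curve `P (S s)` is `C¹`, because `P` is built from the matrices `S s r` by sums and products
(`contDiffOn_induced_of_mem_polyFun`). For the remainder, let `U` and `V` diagonalize `S` and `T`
with joint eigenvalues `x` and `y`. For every function `g` with induced matrix function `G`,
`(Uᴴ (G(T) - G(S)) V) i j = (Uᴴ V) i j * (g (y j) - g (x i))`, and the same identity for the
coordinate functions bounds `‖(Uᴴ V) i j‖ * ‖y j - x i‖` by `‖T - S‖`. Hence `G` inherits, up to the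
factor `n²`, any Lipschitz bound of `g` between the two joint spectra
(`Diagonalizes.norm_induced_sub_le`). If `g` vanishes to first order on the joint spectrum of `S₀`,
that Lipschitz constant tends to `0` as `S, T → S₀`; this includes pairs of eigenvalues near distinct
points of the spectrum, whose distance stays bounded below while `g` tends to `0`. So `G` is strictly
differentiable at `S₀` along `CS d n`, with derivative zero (`induced_isLittleO_of_flat`).

Applied to `R`, this says that near each `t` the curve `F (S s)` differs from a `C¹` curve by one
whose Lipschitz constant tends to `0`, which gives differentiability at `t` and continuity of the
derivative at `t` (`differentiableWithinAt_and_continuousOn_derivWithin_of_approx`).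
-/

open Filter Topology Asymptotics

namespace MatrixFunction

variable {d n : ℕ}

/-! ### Entries and the operator norm -/

theorem norm_entry_le (M : Matrix (Fin n) (Fin n) ℂ) (i j : Fin n) : ‖M i j‖ ≤ ‖M‖ := by
  have h := M.l2_opNorm_mulVec (EuclideanSpace.single j 1)
  have h2 := PiLp.norm_apply_le ((EuclideanSpace.equiv (Fin n) ℂ).symm <|
    M *ᵥ (EuclideanSpace.single j (1 : ℂ)).ofLp) i
  simp at h h2
  exact h2.trans h

theorem norm_single_eq (i j : Fin n) (a : ℂ) :
    ‖(Matrix.single i j a : Matrix (Fin n) (Fin n) ℂ)‖ = ‖a‖ := by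
  have h := Matrix.l2_opNorm_conjTranspose_mul_self (Matrix.single i j a)
  rw [Matrix.conjTranspose_single, Matrix.single_mul_single_same, ← Matrix.diagonal_single,
    Matrix.l2_opNorm_diagonal, Pi.norm_single] at h
  rw [norm_mul, norm_star] at h
  exact (mul_self_inj (norm_nonneg _) (norm_nonneg _)).mp h.symm

theorem norm_le_sum_entries (M : Matrix (Fin n) (Fin n) ℂ) : ‖M‖ ≤ ∑ i, ∑ j, ‖M i j‖ := by
  conv_lhs => rw [Matrix.matrix_eq_sum_single M]
  refine (norm_sum_le _ _).trans (Finset.sum_le_sum fun i _ => (norm_sum_le _ _).trans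
    (Finset.sum_le_sum fun j _ => (norm_single_eq i j _).le))

/-! ### Comparison of two diagonalizations -/

/-- The difference of two diagonalized matrices, read in mixed eigenbases: only the differences
of the eigenvalues appear. -/
theorem conj_sub_apply (U V : Matrix.unitaryGroup (Fin n) ℂ) (a b : Fin n → ℂ) (i j : Fin n) :
    ((U : Matrix (Fin n) (Fin n) ℂ)ᴴ *
      ((V : Matrix (Fin n) (Fin n) ℂ) * Matrix.diagonal b * (V : Matrix (Fin n) (Fin n) ℂ)ᴴ -
        (U : Matrix (Fin n) (Fin n) ℂ) * Matrix.diagonal a * (U : Matrix (Fin n) (Fin n) ℂ)ᴴ) *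
      (V : Matrix (Fin n) (Fin n) ℂ)) i j =
    ((U : Matrix (Fin n) (Fin n) ℂ)ᴴ * (V : Matrix (Fin n) (Fin n) ℂ)) i j * (b j - a i) := by
  have hU : (U : Matrix (Fin n) (Fin n) ℂ)ᴴ * (U : Matrix (Fin n) (Fin n) ℂ) = 1 :=
    Matrix.UnitaryGroup.star_mul_self U
  have hV : (V : Matrix (Fin n) (Fin n) ℂ)ᴴ * (V : Matrix (Fin n) (Fin n) ℂ) = 1 :=
    Matrix.UnitaryGroup.star_mul_self V
  have : (U : Matrix (Fin n) (Fin n) ℂ)ᴴ *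
      ((V : Matrix (Fin n) (Fin n) ℂ) * Matrix.diagonal b * (V : Matrix (Fin n) (Fin n) ℂ)ᴴ -
        (U : Matrix (Fin n) (Fin n) ℂ) * Matrix.diagonal a * (U : Matrix (Fin n) (Fin n) ℂ)ᴴ) *
      (V : Matrix (Fin n) (Fin n) ℂ) =
      ((U : Matrix (Fin n) (Fin n) ℂ)ᴴ * (V : Matrix (Fin n) (Fin n) ℂ)) * Matrix.diagonal b -
      Matrix.diagonal a * ((U : Matrix (Fin n) (Fin n) ℂ)ᴴ * (V : Matrix (Fin n) (Fin n) ℂ)) := by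
    rw [mul_sub, sub_mul]
    simp only [Matrix.mul_assoc, hV, Matrix.mul_one]
    rw [← Matrix.mul_assoc (U : Matrix (Fin n) (Fin n) ℂ)ᴴ (U : Matrix (Fin n) (Fin n) ℂ), hU,
      Matrix.one_mul]
  rw [this, Matrix.sub_apply, Matrix.mul_diagonal, Matrix.diagonal_mul]
  ring

theorem norm_conj_unitary (U V : Matrix.unitaryGroup (Fin n) ℂ) (M : Matrix (Fin n) (Fin n) ℂ) :
    ‖(U : Matrix (Fin n) (Fin n) ℂ)ᴴ * M * (V : Matrix (Fin n) (Fin n) ℂ)‖ = ‖M‖ := by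
  rw [CStarRing.norm_mul_mem_unitary _ V.2]
  exact CStarRing.norm_mem_unitary_mul _ (Unitary.star_mem U.2)

/-- Eigenvectors of `S` and `T` overlap little when their joint eigenvalues are far apart compared
to `‖T - S‖`. -/
theorem Diagonalizes.norm_link_mul_dist_le {S T : Fin d → Matrix (Fin n) (Fin n) ℂ}
    {U V : Matrix.unitaryGroup (Fin n) ℂ} {x y : Fin n → Fin d → ℝ}
    (hU : Diagonalizes U x S) (hV : Diagonalizes V y T) (i j : Fin n) :
    ‖((U : Matrix (Fin n) (Fin n) ℂ)ᴴ * (V : Matrix (Fin n) (Fin n) ℂ)) i j‖ * ‖y j - x i‖ ≤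
      ‖T - S‖ := by
  set w := ((U : Matrix (Fin n) (Fin n) ℂ)ᴴ * (V : Matrix (Fin n) (Fin n) ℂ)) i j with hw
  have h : ‖‖w‖ • (y j - x i)‖ ≤ ‖T - S‖ := by
    refine (pi_norm_le_iff_of_nonneg (norm_nonneg _)).mpr fun r => ?_
    have e := conj_sub_apply U V (fun i => (x i r : ℂ)) (fun j => (y j r : ℂ)) i j
    rw [← hU r, ← hV r, ← hw] at e
    calc ‖(‖w‖ • (y j - x i)) r‖ = ‖w * ((y j r : ℂ) - x i r)‖ := by
          rw [← Complex.ofReal_sub, norm_mul, Complex.norm_real]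
          simp
      _ = ‖((U : Matrix (Fin n) (Fin n) ℂ)ᴴ * (T - S) r *
            (V : Matrix (Fin n) (Fin n) ℂ)) i j‖ := by
          rw [← e, Pi.sub_apply]
      _ ≤ _ := norm_entry_le _ _ _
      _ = ‖(T - S) r‖ := norm_conj_unitary U V _
      _ ≤ _ := norm_le_pi_norm _ r
  simpa [norm_smul] using h

/-- A Lipschitz bound of `g` between the two joint spectra passes to the induced matrix function,
without any condition on `g` within one of the spectra. -/
theorem Diagonalizes.norm_induced_sub_le {S T : Fin d → Matrix (Fin n) (Fin n) ℂ}
    {U V : Matrix.unitaryGroup (Fin n) ℂ} {x y : Fin n → Fin d → ℝ}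
    (hU : Diagonalizes U x S) (hV : Diagonalizes V y T) {g : (Fin d → ℝ) → ℝ} {ε : ℝ}
    (hε : 0 ≤ ε) (hg : ∀ i j, ‖g (y j) - g (x i)‖ ≤ ε * ‖y j - x i‖) :
    ‖induced g T - induced g S‖ ≤ (n : ℝ) ^ 2 * ε * ‖T - S‖ := by
  rw [induced_eq g hU, induced_eq g hV, ← norm_conj_unitary U V]
  refine (norm_le_sum_entries _).trans ?_
  calc _ ≤ ∑ i : Fin n, ∑ j : Fin n, ε * ‖T - S‖ := by
        refine Finset.sum_le_sum fun i _ => Finset.sum_le_sum fun j _ => ?_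
        rw [conj_sub_apply, norm_mul, ← Complex.ofReal_sub, Complex.norm_real]
        calc _ ≤ _ := mul_le_mul_of_nonneg_left (hg i j) (norm_nonneg _)
          _ = ε * (‖((U : Matrix (Fin n) (Fin n) ℂ)ᴴ * (V : Matrix (Fin n) (Fin n) ℂ)) i j‖ *
                ‖y j - x i‖) := by ring
          _ ≤ _ := mul_le_mul_of_nonneg_left (hU.norm_link_mul_dist_le hV i j) hε
    _ = _ := by simp; ring

/-- Every joint eigenvalue of `T` lies within `n * ‖T - S‖` of one of `S`: a column of the unitary
matrix `Uᴴ V` has an entry of modulus at least `1 / n`. -/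
theorem Diagonalizes.exists_dist_le {S T : Fin d → Matrix (Fin n) (Fin n) ℂ}
    {U V : Matrix.unitaryGroup (Fin n) ℂ} {x y : Fin n → Fin d → ℝ}
    (hU : Diagonalizes U x S) (hV : Diagonalizes V y T) (j : Fin n) :
    ∃ i, ‖y j - x i‖ ≤ n * ‖T - S‖ := by
  set W : Matrix (Fin n) (Fin n) ℂ :=
    (U : Matrix (Fin n) (Fin n) ℂ)ᴴ * (V : Matrix (Fin n) (Fin n) ℂ) with hWdef
  have hWu : W ∈ Matrix.unitaryGroup (Fin n) ℂ := (U⁻¹ * V).2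
  have hcol : (1 : ℝ) ≤ ∑ i, ‖W i j‖ := by
    have h1 : (Wᴴ * W) j j = 1 := by
      rw [show Wᴴ * W = 1 from Matrix.mem_unitaryGroup_iff'.mp hWu, Matrix.one_apply_eq]
    rw [Matrix.mul_apply] at h1
    calc (1 : ℝ) = ‖∑ i, Wᴴ j i * W i j‖ := by rw [h1, norm_one]
      _ ≤ ∑ i, ‖W i j‖ := by
        refine (norm_sum_le _ _).trans (Finset.sum_le_sum fun i _ => ?_)
        rw [Matrix.conjTranspose_apply, norm_mul, norm_star]
        exact mul_le_of_le_one_left (norm_nonneg _) (entry_norm_bound_of_unitary hWu i j)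
  have hn : (0 : ℝ) < n := by exact_mod_cast j.pos
  obtain ⟨i, -, hi⟩ := Finset.exists_le_of_sum_le (s := Finset.univ) ⟨j, Finset.mem_univ j⟩
    (f := fun _ => (n : ℝ)⁻¹) (g := fun i => ‖W i j‖) (by simpa [hn.ne'] using hcol)
  refine ⟨i, ?_⟩
  have h := hU.norm_link_mul_dist_le hV i j
  have h2 := (mul_le_mul_of_nonneg_right hi (norm_nonneg (y j - x i))).trans h
  rwa [inv_mul_le_iff₀ hn] at h2

/-! ### Functions vanishing to first order on the joint spectrum -/

/-- A function that vanishes to first order on a compact set `Z` is `ε`-Lipschitz between any two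
points close to `Z`, including points close to different points of `Z`. -/
theorem eventually_norm_sub_le_of_flat {Z : Set (Fin d → ℝ)} (hZ : IsCompact Z)
    {g : (Fin d → ℝ) → ℝ} (hg0 : ∀ z ∈ Z, g z = 0)
    (hg : ∀ z ∈ Z, HasStrictFDerivAt g (0 : (Fin d → ℝ) →L[ℝ] ℝ) z) {ε : ℝ} (hε : 0 < ε) :
    ∀ᶠ p in 𝓝ˢ Z ×ˢ 𝓝ˢ Z, ‖g p.1 - g p.2‖ ≤ ε * ‖p.1 - p.2‖ := by
  rw [← hZ.nhdsSet_prod_eq hZ, eventually_nhdsSet_iff_forall]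
  rintro ⟨z, w⟩ ⟨hz, hw⟩
  by_cases h : z = w
  · subst h
    have := (hg z hz).isLittleO.def hε
    simpa using this
  · have hc : ContinuousAt (fun p : (Fin d → ℝ) × (Fin d → ℝ) => ‖g p.1 - g p.2‖) (z, w) :=
      (((hg z hz).continuousAt.comp continuousAt_fst).sub
        (ContinuousAt.comp (x := (z, w)) (hg w hw).continuousAt continuousAt_snd)).norm
    have hc' : ContinuousAt (fun p : (Fin d → ℝ) × (Fin d → ℝ) => ε * ‖p.1 - p.2‖) (z, w) := by
      fun_prop
    have hlt : ‖g z - g w‖ < ε * ‖z - w‖ := by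
      rw [hg0 z hz, hg0 w hw, sub_self, norm_zero]
      exact mul_pos hε (norm_pos_iff.mpr (sub_ne_zero.mpr h))
    exact (hc.eventually_lt hc' hlt).mono fun _ h => h.le

/-- If `g` vanishes to first order on the joint spectrum of `S₀`, then the induced matrix function
is strictly differentiable at `S₀` along `CS d n`, with derivative zero. -/
theorem induced_isLittleO_of_flat {S₀ : Fin d → Matrix (Fin n) (Fin n) ℂ} (hS₀ : S₀ ∈ CS d n)
    {g : (Fin d → ℝ) → ℝ} (hg0 : ∀ z ∈ jointSpectrum S₀, g z = 0)
    (hg : ∀ z ∈ jointSpectrum S₀, HasStrictFDerivAt g (0 : (Fin d → ℝ) →L[ℝ] ℝ) z) :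
    (fun p : (Fin d → Matrix (Fin n) (Fin n) ℂ) × (Fin d → Matrix (Fin n) (Fin n) ℂ) =>
      induced g p.1 - induced g p.2) =o[𝓝[CS d n] S₀ ×ˢ 𝓝[CS d n] S₀] fun p => p.1 - p.2 := by
  obtain ⟨U, x, hU⟩ := exists_diagonalizes hS₀
  have hZ : IsCompact (jointSpectrum S₀) := by
    rw [jointSpectrum_eq hU]; exact (Set.finite_range x).isCompact
  -- The joint spectrum is upper semicontinuous at `S₀`.
  have hN : ∀ {A : Set (Fin d → ℝ)}, A ∈ 𝓝ˢ (jointSpectrum S₀) →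
      ∀ᶠ T in 𝓝[CS d n] S₀, ∀ V y, Diagonalizes V y T → ∀ j, y j ∈ A := by
    intro A hA
    obtain ⟨δ, hδ, hδA⟩ := (Metric.hasBasis_nhdsSet_thickening hZ).mem_iff.mp hA
    have ht : Tendsto (fun T => (n : ℝ) * ‖T - S₀‖) (𝓝[CS d n] S₀) (𝓝 0) := by
      have : ContinuousAt (fun T => (n : ℝ) * ‖T - S₀‖) S₀ := by fun_prop
      have h := this.tendsto.mono_left (nhdsWithin_le_nhds (s := CS d n))
      simpa using h
    filter_upwards [ht.eventually_lt_const hδ] with T hT V y hV j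
    obtain ⟨i, hi⟩ := hU.exists_dist_le hV j
    refine hδA (Metric.mem_thickening_iff.mpr ⟨x i, ?_, ?_⟩)
    · rw [jointSpectrum_eq hU]; exact ⟨i, rfl⟩
    · rw [dist_eq_norm]; exact hi.trans_lt hT
  rw [isLittleO_iff]
  intro c hc
  -- The denominator is `n ^ 2 + 1` rather than `n ^ 2`, so that `n = 0` needs no special case.
  have hε : 0 < c / ((n : ℝ) ^ 2 + 1) := by positivity
  obtain ⟨A, hA, B, hB, hAB⟩ := Filter.eventually_prod_iff.mp
    (eventually_norm_sub_le_of_flat hZ hg0 hg hε)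
  have hCS : ∀ᶠ T in 𝓝[CS d n] S₀, T ∈ CS d n := eventually_mem_nhdsWithin
  filter_upwards [((hN hA).and hCS).prod_mk ((hN hB).and hCS)] with p ⟨⟨hp1, hp1'⟩, hp2, hp2'⟩
  obtain ⟨V, y, hV⟩ := exists_diagonalizes hp1'
  obtain ⟨W, z, hW⟩ := exists_diagonalizes hp2'
  refine (hW.norm_induced_sub_le hV hε.le fun i j =>
    hAB (hp1 V y hV j) (hp2 W z hW i)).trans ?_
  refine mul_le_mul_of_nonneg_right ?_ (norm_nonneg _)
  rw [← mul_div_assoc, div_le_iff₀ (by positivity)]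
  nlinarith

/-! ### Functional calculus on commuting tuples -/

theorem induced_add {S : Fin d → Matrix (Fin n) (Fin n) ℂ} (hS : S ∈ CS d n)
    (f g : (Fin d → ℝ) → ℝ) : induced (f + g) S = induced f S + induced g S := by
  obtain ⟨U, x, hU⟩ := exists_diagonalizes hS
  rw [induced_eq _ hU, induced_eq _ hU, induced_eq _ hU, ← add_mul, ← mul_add,
    Matrix.diagonal_add]
  simp

theorem induced_sub {S : Fin d → Matrix (Fin n) (Fin n) ℂ} (hS : S ∈ CS d n)
    (f g : (Fin d → ℝ) → ℝ) : induced (f - g) S = induced f S - induced g S := by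
  rw [eq_sub_iff_add_eq, ← induced_add hS, sub_add_cancel]

theorem induced_mul {S : Fin d → Matrix (Fin n) (Fin n) ℂ} (hS : S ∈ CS d n)
    (f g : (Fin d → ℝ) → ℝ) : induced (f * g) S = induced f S * induced g S := by
  obtain ⟨U, x, hU⟩ := exists_diagonalizes hS
  have hUU : (U : Matrix (Fin n) (Fin n) ℂ)ᴴ * (U : Matrix (Fin n) (Fin n) ℂ) = 1 :=
    Matrix.UnitaryGroup.star_mul_self U
  have hD : Matrix.diagonal (fun i => (((f * g) (x i) : ℝ) : ℂ)) =
      Matrix.diagonal (fun i => (f (x i) : ℂ)) * Matrix.diagonal (fun i => (g (x i) : ℂ)) := by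
    simp [Matrix.diagonal_mul_diagonal]
  rw [induced_eq _ hU, induced_eq _ hU, induced_eq _ hU, hD]
  simp only [Matrix.mul_assoc]
  rw [← Matrix.mul_assoc (U : Matrix (Fin n) (Fin n) ℂ)ᴴ (U : Matrix (Fin n) (Fin n) ℂ), hUU,
    Matrix.one_mul]

theorem induced_const {S : Fin d → Matrix (Fin n) (Fin n) ℂ} (hS : S ∈ CS d n) (c : ℝ) :
    induced (fun _ => c) S = Matrix.diagonal (fun _ => (c : ℂ)) := by
  obtain ⟨U, x, hU⟩ := exists_diagonalizes hS
  rw [induced_eq _ hU, ← Matrix.smul_one_eq_diagonal, Matrix.mul_smul, Matrix.mul_one,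
    Matrix.smul_mul, show (U : Matrix (Fin n) (Fin n) ℂ) * (U : Matrix (Fin n) (Fin n) ℂ)ᴴ = 1 from
      Matrix.mem_unitaryGroup_iff.mp U.2]

theorem induced_coord {S : Fin d → Matrix (Fin n) (Fin n) ℂ} (hS : S ∈ CS d n) (r : Fin d) :
    induced (fun x => x r) S = S r := by
  obtain ⟨U, x, hU⟩ := exists_diagonalizes hS
  rw [induced_eq _ hU, ← hU r]

/-! ### Polynomial functions -/

/-- The algebra of polynomial functions on `ℝ^d`, generated by the coordinates; its
elements are functions rather than formal polynomials. -/
def polyFun (d : ℕ) : Subalgebra ℝ ((Fin d → ℝ) → ℝ) :=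
  Algebra.adjoin ℝ (Set.range fun (r : Fin d) (x : Fin d → ℝ) => x r)

theorem coord_mem_polyFun (r : Fin d) : (fun x : Fin d → ℝ => x r) ∈ polyFun d :=
  Algebra.subset_adjoin ⟨r, rfl⟩

theorem const_mem_polyFun (c : ℝ) : (fun _ : Fin d → ℝ => c) ∈ polyFun d :=
  (polyFun d).algebraMap_mem c

theorem continuousLinearMap_mem_polyFun (L : (Fin d → ℝ) →L[ℝ] ℝ) : (L : (Fin d → ℝ) → ℝ) ∈
    polyFun d := by
  have h : (L : (Fin d → ℝ) → ℝ) = ∑ r, (fun _ => L fun j => if r = j then 1 else 0) *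
      (fun x => x r) := by
    ext x
    have := LinearMap.pi_apply_eq_sum_univ (L : (Fin d → ℝ) →ₗ[ℝ] ℝ) x
    simpa [mul_comm, Finset.sum_apply] using this
  rw [h]
  exact sum_mem fun r _ => mul_mem (const_mem_polyFun _) (coord_mem_polyFun r)

theorem contDiff_of_mem_polyFun {p : (Fin d → ℝ) → ℝ} (hp : p ∈ polyFun d) : ContDiff ℝ 1 p := by
  induction hp using Algebra.adjoin_induction with
  | mem q hq => obtain ⟨r, rfl⟩ := hq; exact contDiff_apply ℝ ℝ r
  | algebraMap c => exact contDiff_const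
  | add p q _ _ hp hq => exact hp.add hq
  | mul p q _ _ hp hq => exact hp.mul hq

theorem hasFDerivAt_of_mem_polyFun {p : (Fin d → ℝ) → ℝ} (hp : p ∈ polyFun d) (x : Fin d → ℝ) :
    HasFDerivAt p (fderiv ℝ p x) x :=
  ((contDiff_of_mem_polyFun hp).differentiable one_ne_zero x).hasFDerivAt

theorem contDiffOn_induced_of_mem_polyFun {p : (Fin d → ℝ) → ℝ} (hp : p ∈ polyFun d)
    {I : Set ℝ} {S : ℝ → Fin d → Matrix (Fin n) (Fin n) ℂ} (hS : ContDiffOn ℝ 1 S I)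
    (hCS : ∀ t ∈ I, S t ∈ CS d n) : ContDiffOn ℝ 1 (fun t => induced p (S t)) I := by
  induction hp using Algebra.adjoin_induction with
  | mem q hq =>
    obtain ⟨r, rfl⟩ := hq
    exact ((contDiff_apply ℝ _ r).comp_contDiffOn hS).congr fun t ht => induced_coord (hCS t ht) r
  | algebraMap c => exact contDiffOn_const.congr fun t ht => induced_const (hCS t ht) c
  | add p q _ _ hp hq =>
    exact (hp.add hq).congr fun t ht => induced_add (hCS t ht) p q
  | mul p q _ _ hp hq => exact (hp.mul hq).congr fun t ht => induced_mul (hCS t ht) p q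

/-! ### Hermite interpolation -/

/-- A polynomial function with value `1` at `z`, value `0` on `Z`, and derivative zero at all these
points. -/
theorem exists_polyFun_bump (z : Fin d → ℝ) (Z : Finset (Fin d → ℝ)) (hz : z ∉ Z) :
    ∃ e ∈ polyFun d, e z = 1 ∧ HasFDerivAt e (0 : (Fin d → ℝ) →L[ℝ] ℝ) z ∧
      ∀ w ∈ Z, e w = 0 ∧ HasFDerivAt e (0 : (Fin d → ℝ) →L[ℝ] ℝ) w := by
  induction Z using Finset.induction_on with
  | empty => exact ⟨fun _ => 1, const_mem_polyFun 1, rfl, hasFDerivAt_const _ _, by simp⟩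
  | insert w Z _ ih =>
    rw [Finset.mem_insert, not_or] at hz
    obtain ⟨e, he, hez, hez', heZ⟩ := ih hz.2
    obtain ⟨r, hr⟩ := Function.ne_iff.mp hz.1
    have hr' : z r - w r ≠ 0 := sub_ne_zero.mpr hr
    let q : (Fin d → ℝ) → ℝ := fun x => (x r - w r) * (z r - w r)⁻¹
    have hq : q ∈ polyFun d := mul_mem (sub_mem (coord_mem_polyFun r) (const_mem_polyFun (w r)))
      (const_mem_polyFun (z r - w r)⁻¹)
    have hqd := hasFDerivAt_of_mem_polyFun hq
    have hed := hasFDerivAt_of_mem_polyFun he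
    have hqz : q z = 1 := mul_inv_cancel₀ hr'
    have hqw : q w = 0 := by simp [q]
    -- `h = 1 - (1 - q²)²` is `1` to first order where `q = 1`, and `0` to first order where `q = 0`.
    let h : (Fin d → ℝ) → ℝ := (q * q) * ((fun _ => 2) - q * q)
    have hh : h ∈ polyFun d := mul_mem (mul_mem hq hq) (sub_mem (const_mem_polyFun 2)
      (mul_mem hq hq))
    have hhd : ∀ x, HasFDerivAt h _ x := fun x =>
      ((hqd x).mul (hqd x)).mul ((hasFDerivAt_const (2 : ℝ) x).sub ((hqd x).mul (hqd x)))
    refine ⟨e * h, mul_mem he hh, ?_, ?_, fun v hv => ?_⟩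
    · simp [h, hez, hqz]; norm_num
    · refine (hez'.mul (hhd z)).congr_fderiv ?_
      ext v
      simp [h, hez, hqz]
      ring
    · rcases Finset.mem_insert.mp hv with rfl | hv
      · refine ⟨by simp [h, hqw], ((hed v).mul (hhd v)).congr_fderiv ?_⟩
        ext u
        simp [h, hqw]
      · obtain ⟨h0, h1⟩ := heZ v hv
        refine ⟨by simp [h0], (h1.mul (hhd v)).congr_fderiv ?_⟩
        ext u
        simp [h0]

/-- Hermite interpolation of first order: a polynomial function with prescribed values and
derivatives at finitely many points of `ℝ^d`. -/
theorem exists_polyFun_hermite (Z : Finset (Fin d → ℝ)) (a : (Fin d → ℝ) → ℝ)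
    (L : (Fin d → ℝ) → (Fin d → ℝ) →L[ℝ] ℝ) :
    ∃ p ∈ polyFun d, ∀ z ∈ Z, p z = a z ∧ HasFDerivAt p (L z) z := by
  induction Z using Finset.induction_on with
  | empty => exact ⟨fun _ => 0, const_mem_polyFun 0, by simp⟩
  | insert z Z hz ih =>
    obtain ⟨p, hp, hpZ⟩ := ih
    obtain ⟨e, he, hez, hez', heZ⟩ := exists_polyFun_bump z Z hz
    have hpd := hasFDerivAt_of_mem_polyFun hp
    -- The affine function `q` carries the value and the derivative still missing at `z`; the factor
    -- `e` keeps this correction from changing anything at the points of `Z`.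
    let M : (Fin d → ℝ) →L[ℝ] ℝ := L z - fderiv ℝ p z
    let q : (Fin d → ℝ) → ℝ := (M : (Fin d → ℝ) → ℝ) + fun _ => a z - p z - M z
    have hq : q ∈ polyFun d := add_mem (continuousLinearMap_mem_polyFun M) (const_mem_polyFun _)
    have hqd : ∀ x, HasFDerivAt q M x := fun x => M.hasFDerivAt.add_const _
    refine ⟨p + e * q, add_mem hp (mul_mem he hq), fun w hw => ?_⟩
    rcases Finset.mem_insert.mp hw with rfl | hw
    · refine ⟨by simp [hez, q], ((hpd w).add (hez'.mul (hqd w))).congr_fderiv ?_⟩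
      simp [hez, M]
    · obtain ⟨h0, h1⟩ := heZ w hw
      obtain ⟨h2, h3⟩ := hpZ w hw
      refine ⟨by simp [h0, h2], (h3.add (h1.mul (hqd w))).congr_fderiv ?_⟩
      simp [h0]

end MatrixFunction

/-! ### Curves approximated by `C¹` curves -/

section

variable {E : Type*} [NormedAddCommGroup E] [NormedSpace ℝ E]

theorem norm_le_of_hasDerivWithinAt_of_eventually {R : ℝ → E} {R' : E} {I : Set ℝ} {s c : ℝ}
    (hs : UniqueDiffWithinAt ℝ I s) (hR : HasDerivWithinAt R R' I s)
    (hc : ∀ᶠ u in 𝓝[I] s, ‖R u - R s‖ ≤ c * ‖u - s‖) : ‖R'‖ ≤ c := by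
  have hne : (𝓝[I \ {s}] s).NeBot := by
    rw [← accPt_principal_iff_nhdsWithin]
    exact hs.accPt
  refine le_of_tendsto (hasDerivWithinAt_iff_tendsto_slope.mp hR).norm ?_
  filter_upwards [hc.filter_mono (nhdsWithin_mono s Set.sdiff_subset),
    self_mem_nhdsWithin] with u hu hus
  have : 0 < ‖u - s‖ := norm_pos_iff.mpr (sub_ne_zero.mpr hus.2)
  rw [slope_def_module, norm_smul, norm_inv, inv_mul_le_iff₀ this, mul_comm]
  exact hu

/-- If near every point `t` of `I` the curve `G` differs from some `C¹` curve `Q`, which may depend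
on `t`, by a curve that is strictly differentiable at `t` within `I` with derivative zero, then `G` is
`C¹` on `I`. -/
theorem differentiableWithinAt_and_continuousOn_derivWithin_of_approx {G : ℝ → E} {I : Set ℝ}
    (hI : UniqueDiffOn ℝ I)
    (h : ∀ t ∈ I, ∃ Q : ℝ → E, ContDiffOn ℝ 1 Q I ∧
      (fun p : ℝ × ℝ => (G p.1 - Q p.1) - (G p.2 - Q p.2)) =o[𝓝[I] t ×ˢ 𝓝[I] t]
        fun p => p.1 - p.2) :
    (∀ t ∈ I, DifferentiableWithinAt ℝ G I t) ∧ ContinuousOn (derivWithin G I) I := by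
  have key : ∀ t ∈ I, ∀ Q : ℝ → E, ContDiffOn ℝ 1 Q I →
      (fun p : ℝ × ℝ => (G p.1 - Q p.1) - (G p.2 - Q p.2)) =o[𝓝[I] t ×ˢ 𝓝[I] t]
        (fun p => p.1 - p.2) → HasDerivWithinAt G (derivWithin Q I t) I t := by
    intro t ht Q hQ hGQ
    have hR : HasDerivWithinAt (fun s => G s - Q s) 0 I t := by
      rw [hasDerivWithinAt_iff_isLittleO]
      have h1 : Tendsto (fun s : ℝ => (s, t)) (𝓝[I] t) (𝓝[I] t ×ˢ 𝓝[I] t) :=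
        tendsto_id.prodMk (tendsto_const_pure.mono_right (pure_le_nhdsWithin ht))
      simpa [Function.comp_def] using hGQ.comp_tendsto h1
    have := hR.add ((hQ.differentiableOn one_ne_zero) t ht).hasDerivWithinAt
    simpa [Function.comp_def, Pi.add_def] using this
  have hd : ∀ t ∈ I, DifferentiableWithinAt ℝ G I t := fun t ht => by
    obtain ⟨Q, hQ, hGQ⟩ := h t ht
    exact (key t ht Q hQ hGQ).differentiableWithinAt
  refine ⟨hd, fun t ht => ?_⟩
  obtain ⟨Q, hQ, hGQ⟩ := h t ht
  have hQc : ContinuousWithinAt (derivWithin Q I) I t := hQ.continuousOn_derivWithin hI le_rfl t ht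
  -- Near `t` the difference `G - Q` has small Lipschitz constant, which bounds its derivative.
  have hR0 : Tendsto (fun s => derivWithin G I s - derivWithin Q I s) (𝓝[I] t) (𝓝 0) := by
    rw [Metric.tendsto_nhds]
    intro ε hε
    obtain ⟨A, hA, B, hB, hAB⟩ := Filter.eventually_prod_iff.mp (hGQ.def (half_pos hε))
    filter_upwards [eventually_eventually_nhdsWithin.mpr hA, hB, self_mem_nhdsWithin]
      with s hsA hsB hsI
    rw [dist_zero_right]
    refine (norm_le_of_hasDerivWithinAt_of_eventually (hI s hsI)
      ((hd s hsI).hasDerivWithinAt.sub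
        ((hQ.differentiableOn one_ne_zero) s hsI).hasDerivWithinAt)
      (hsA.mono fun u hu => hAB hu hsB)).trans_lt (half_lt_self hε)
  have hGt : derivWithin G I t = 0 + derivWithin Q I t := by
    rw [zero_add]; exact (key t ht Q hQ hGQ).derivWithin (hI t ht)
  rw [ContinuousWithinAt, hGt]
  simpa using hR0.add hQc

end

theorem theorem3p2 {d n : ℕ} (I : Set ℝ) (hI : I.OrdConnected)
    (S : ℝ → Fin d → Matrix (Fin n) (Fin n) ℂ) (hS : ContDiffOn ℝ 1 S I)
    (hCS : ∀ t ∈ I, S t ∈ MatrixFunction.CS d n)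
    (Ω : Set (Fin d → ℝ)) (hΩ : IsOpen Ω)
    (hspec : ∀ t ∈ I, MatrixFunction.jointSpectrum (S t) ⊆ Ω)
    (f : (Fin d → ℝ) → ℝ) (hf : ContDiffOn ℝ 1 f Ω) :
    (∀ t ∈ I, DifferentiableWithinAt ℝ (fun s => MatrixFunction.induced f (S s)) I t) ∧
      ContinuousOn (derivWithin (fun s => MatrixFunction.induced f (S s)) I) I := by
  open MatrixFunction in
  -- Uniqueness of derivatives within `I` fails for one-point intervals, treated separately.
  rcases I.subsingleton_or_nontrivial with hsub | hnt
  · rcases hsub.eq_empty_or_singleton with rfl | ⟨t, rfl⟩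
    · simp
    · refine ⟨fun s hs => ?_, continuousOn_singleton _ _⟩
      rw [Set.mem_singleton_iff.mp hs]
      exact (hasFDerivWithinAt_singleton _ _).differentiableWithinAt
  have hconv : Convex ℝ I := hI.convex
  have hUD : UniqueDiffOn ℝ I := uniqueDiffOn_convex hconv
    (hconv.nontrivial_iff_nonempty_interior.mp hnt)
  refine differentiableWithinAt_and_continuousOn_derivWithin_of_approx hUD fun t ht => ?_
  obtain ⟨U, x, hU⟩ := exists_diagonalizes (hCS t ht)
  have hfin : (jointSpectrum (S t)).Finite := by
    rw [jointSpectrum_eq hU]; exact Set.finite_range x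
  have hfd : ∀ z ∈ jointSpectrum (S t), HasStrictFDerivAt f (fderiv ℝ f z) z := fun z hz =>
    (hf.contDiffAt (hΩ.mem_nhds (hspec t ht hz))).hasStrictFDerivAt one_ne_zero
  obtain ⟨p, hp, hpZ⟩ := exists_polyFun_hermite hfin.toFinset f (fderiv ℝ f)
  have hflat := induced_isLittleO_of_flat (hCS t ht) (g := f - p)
    (fun z hz => by
      rw [Pi.sub_apply, (hpZ z (hfin.mem_toFinset.mpr hz)).1, sub_self])
    (fun z hz => by
      have h1 := (contDiff_of_mem_polyFun hp).contDiffAt.hasStrictFDerivAt'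
        (hpZ z (hfin.mem_toFinset.mpr hz)).2 one_ne_zero
      have h2 := (hfd z hz).sub h1
      rwa [sub_self] at h2)
  refine ⟨fun s => induced p (S s), contDiffOn_induced_of_mem_polyFun hp hS hCS, ?_⟩
  have hSt : Tendsto S (𝓝[I] t) (𝓝[CS d n] (S t)) :=
    tendsto_nhdsWithin_iff.mpr ⟨hS.continuousOn t ht, eventually_mem_nhdsWithin.mono hCS⟩
  obtain ⟨K, A, hA, hK⟩ := (hS t ht).exists_lipschitzOnWith hconv
  have hlip : (fun q : ℝ × ℝ => S q.1 - S q.2) =O[𝓝[I] t ×ˢ 𝓝[I] t] fun q => q.1 - q.2 := by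
    refine IsBigO.of_bound K ?_
    filter_upwards [prod_mem_prod hA hA] with q hq
    exact hK.norm_sub_le hq.1 hq.2
  refine ((hflat.comp_tendsto (hSt.prodMap hSt)).trans_isBigO hlip).congr' ?_ EventuallyEq.rfl
  filter_upwards [prod_mem_prod self_mem_nhdsWithin self_mem_nhdsWithin] with q hq
  simp [induced_sub (hCS _ hq.1), induced_sub (hCS _ hq.2)]
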